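/- Let $V$ be a 4-dimensional real vector space with a Lorentzian metric $g_{ab}$ of signature $(+,-,-,-)$ (for instance the tangent space at a point of a 4-dimensional Lorentzian manifold); indices are raised and lowered with $g$. For a 2-form $F_{ab}=F_{[ab]}$ on $V$ let $$T_{ab}\{F\} = -F_{ac}F_b{}^c + \tfrac14\,(F_{cd}F^{cd})\,g_{ab}$$ be its Maxwell energy-momentum tensor, and for a rank-2 tensor $T_{ab}$ put $(T\times T)_{ab}=T_{ac}T_b{}^c$. Then a tensor $T_{ab}$ on $V$ is, up to sign, the Maxwell energy-momentum tensor of a 2-form, that is, $T_{ab}=T_{ab}\{F\}$ or $T_{ab}=-T_{ab}\{F\}$ for some 2-form $F_{ab}$, if and only if $T_{ab}$ is symmetric, $(T\times T)_{ab}=f\,g_{ab}$ for some $f\in\mathbb{R}$, and $T_a{}^a=0$. -/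

import Mathlib

/-- A Lorentzian metric `g_ab` on a finite-dimensional real vector space (the tangent space at a
point of a Lorentzian manifold): a bilinear form with signature `(+, -, …, -)`, that is, one which
admits an orthonormal basis `e_0, …, e_n` with `g(e_0, e_0) = 1` and `g(e_i, e_i) = -1` for
`i ≥ 1`. -/
structure LorentzianMetric (V : Type*) [AddCommGroup V] [Module ℝ V] where
  form : LinearMap.BilinForm ℝ V
  exists_orthonormal_basis : ∃ (n : ℕ) (e : Module.Basis (Fin (n + 1)) ℝ V), ∀ i j,
    form (e i) (e j) = if i = j then (if i = 0 then 1 else -1) else 0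

namespace LorentzianMetric

variable {V : Type*} [AddCommGroup V] [Module ℝ V]

theorem form_nondegenerate (g : LorentzianMetric V) : g.form.Nondegenerate := by
  obtain ⟨n, e, he⟩ := g.exists_orthonormal_basis
  have hO : g.form.IsOrthoᵢ e := by
    intro i j hij
    show g.form (e i) (e j) = 0
    rw [he, if_neg hij]
  refine hO.nondegenerate_of_not_isOrtho_basis_self e ?_
  intro i hi
  have h : g.form (e i) (e i) = 0 := hi
  rw [he, if_pos rfl] at h
  split_ifs at h <;> norm_num at h

variable [FiniteDimensional ℝ V]

/-- Raising the second index: `T_a{}^b`, as the endomorphism `u ↦ u^a T_a{}^b`, which is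
characterised by `g (raise T u) v = T u v`. -/
noncomputable def raise (g : LorentzianMetric V) (T : LinearMap.BilinForm ℝ V) : V →ₗ[ℝ] V :=
  (g.form.toDual g.form_nondegenerate).symm.toLinearMap ∘ₗ T

theorem form_raise (g : LorentzianMetric V) (T : LinearMap.BilinForm ℝ V) (u v : V) :
    g.form (g.raise T u) v = T u v := by
  simp [raise]

/-- The trace `T_a{}^a`. -/
noncomputable def trace (g : LorentzianMetric V) (T : LinearMap.BilinForm ℝ V) : ℝ :=
  LinearMap.trace ℝ V (g.raise T)

/-- The contracted product `(S × T)_ab = S_ac T_b{}^c`. -/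
noncomputable def cross (g : LorentzianMetric V) (S T : LinearMap.BilinForm ℝ V) :
    LinearMap.BilinForm ℝ V :=
  S.compl₂ (g.raise T)

/-- The full contraction `S · T = S_ab T^ab = g^ab S_ac T_b{}^c`. -/
noncomputable def dot (g : LorentzianMetric V) (S T : LinearMap.BilinForm ℝ V) : ℝ :=
  g.trace (g.cross S T)

/-- The energy-momentum tensor of a Maxwell field `F`, in signature `(+, -, …, -)`:
`T_ab{F} = - F_ac F_b{}^c + (1/4) (F · F) g_ab`. -/
noncomputable def maxwellTensor (g : LorentzianMetric V) (F : LinearMap.BilinForm ℝ V) :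
    LinearMap.BilinForm ℝ V :=
  -g.cross F F + ((1 / 4 : ℝ) * g.dot F F) • g.form

end LorentzianMetric

/-!
Let `φ = F_a{}^b` and `τ = T_a{}^b`. Since `φ` is skew-adjoint, its characteristic polynomial `χ`
is also that of `-φ`, so `χ²` is a polynomial in `X²`. In dimension four this leaves
`χ = X⁴ - ½ tr(φ²) X² + det φ`, and by Cayley–Hamilton `τ = φ² - ¼ tr(φ²)` squares to a scalar.

Conversely, let `τ` be self-adjoint and trace-free with `τ² = f`. The signature forces `f ≥ 0`, so
`(τ - √f)(τ + √f) = 0` and one of the eigenspaces has dimension at least two. It contains a vector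
`p` with `g(p, p) = -1`; let `τ p = l p`. Then `σ = τ + l + 2 l p_a p^b` satisfies
`σ² = (tr σ) σ`, so it has rank at most one: if `tr σ ≠ 0` it is a multiple of a projection of
trace one, and otherwise its range is isotropic, hence at most a line. Thus `σ = ± k_a k^b`, which
says that `T` is `±` the Maxwell tensor of `k ∧ p`.
-/

section SkewAdjoint

open Polynomial

theorem matrix_charpoly_mul_charpoly_neg {R n : Type*} [CommRing R] [Fintype n] [DecidableEq n]
    (A : Matrix n n R) : A.charpoly * (-A).charpoly = expand R 2 (A ^ 2).charpoly := by
  have h_factor : A.charmatrix * (-A).charmatrix = (expand R 2).mapMatrix (A ^ 2).charmatrix := by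
    have h_comm : Commute (Matrix.scalar n (X : R[X])) (C.mapMatrix A) :=
      Matrix.scalar_commute _ (Commute.all _) _
    have h_expand : (expand R 2).mapMatrix (A ^ 2).charmatrix =
        Matrix.scalar n (X : R[X]) ^ 2 - C.mapMatrix (A ^ 2) := by
      rw [← map_pow]
      ext1 i j
      by_cases hij : i = j <;> simp [Matrix.charmatrix, hij]
    rw [h_expand, Matrix.charmatrix, Matrix.charmatrix, map_neg, sub_neg_eq_add, map_pow,
      pow_two, pow_two, h_comm.mul_self_sub_mul_self_eq']
  rw [Matrix.charpoly, Matrix.charpoly, Matrix.charpoly, ← Matrix.det_mul, h_factor,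
    AlgHom.map_det]

theorem charpoly_mul_charpoly_neg {R M : Type*} [CommRing R] [AddCommGroup M] [Module R M]
    [Module.Free R M] [Module.Finite R M] (f : Module.End R M) :
    f.charpoly * (-f).charpoly = expand R 2 (f ^ 2).charpoly := by
  rw [LinearMap.charpoly_def, LinearMap.charpoly_def, LinearMap.charpoly_def, map_neg,
    ← LinearMap.toMatrix_pow]
  exact matrix_charpoly_mul_charpoly_neg _

variable {K V : Type*} [Field K] [AddCommGroup V] [Module K V] [FiniteDimensional K V]

theorem charpoly_dualMap (f : Module.End K V) :
    LinearMap.charpoly (LinearMap.dualMap f) = f.charpoly := by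
  let b := Module.Free.chooseBasis K V
  rw [← LinearMap.charpoly_toMatrix _ b.dualBasis, ← LinearMap.charpoly_toMatrix f b,
    ← Matrix.charpoly_transpose, LinearMap.dualMap_def, LinearMap.toMatrix_transpose,
    Matrix.transpose_transpose]

theorem charpoly_eq_of_isAdjointPair {B : LinearMap.BilinForm K V} (hB : B.Nondegenerate)
    {f f' : Module.End K V} (h : LinearMap.IsAdjointPair B B f f') :
    f.charpoly = f'.charpoly := by
  have h_conj : (B.toDual hB).conj f = LinearMap.dualMap f' := by
    ext α v
    obtain ⟨u, rfl⟩ := (B.toDual hB).surjective α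
    simpa [LinearEquiv.conj_apply, LinearMap.BilinForm.toDual_def] using h u v
  rw [← (B.toDual hB).charpoly_conj f, h_conj, charpoly_dualMap]

theorem eq_quartic_of_sq_eq_expand [NeZero (2 : K)] {p q : K[X]} (hp : p.Monic)
    (hp_deg : p.natDegree = 4) (h : p ^ 2 = expand K 2 q) :
    p = X ^ 4 + C (q.coeff 3 / 2) * X ^ 2 + C (p.coeff 0) := by
  have h_two : (2 : K) ≠ 0 := two_ne_zero
  have h_lead : p.coeff 4 = 1 := hp_deg ▸ hp.coeff_natDegree
  have h_high (k : ℕ) (hk : 4 < k) : p.coeff k = 0 := coeff_eq_zero_of_natDegree_lt (hp_deg ▸ hk)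
  have h_sq (k : ℕ) := congr_arg (coeff · k) h
  have h_coeff_three : p.coeff 3 = 0 := by
    simpa [pow_two, coeff_mul, Finset.Nat.antidiagonal_succ, coeff_expand, h_lead, h_high,
      ← two_mul, h_two] using h_sq 7
  have h_coeff_one : p.coeff 1 = 0 := by
    simpa [pow_two, coeff_mul, Finset.Nat.antidiagonal_succ, coeff_expand, h_lead, h_high,
      h_coeff_three, ← two_mul, h_two] using h_sq 5
  have h_coeff_two : p.coeff 2 = q.coeff 3 / 2 := by
    rw [eq_div_iff h_two, mul_two]
    simpa [pow_two, coeff_mul, Finset.Nat.antidiagonal_succ, coeff_expand, h_lead, h_high,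
      h_coeff_three] using h_sq 6
  rw [← h_coeff_two]
  conv_lhs => rw [p.as_sum_range_C_mul_X_pow, hp_deg]
  simp only [Finset.sum_range_succ, Finset.sum_range_zero, h_lead, h_coeff_three,
    h_coeff_one, map_zero, map_one]
  ring

theorem charpoly_coeff_finrank_pred [Nontrivial V] (f : Module.End K V) :
    f.charpoly.coeff (Module.finrank K V - 1) = -LinearMap.trace K V f := by
  rw [LinearMap.trace_eq_matrix_trace K (Module.Free.chooseBasis K V),
    Matrix.trace_eq_neg_charpoly_nextCoeff, neg_neg, LinearMap.charpoly_toMatrix,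
    nextCoeff_of_natDegree_pos (f.charpoly_natDegree ▸ Module.finrank_pos),
    LinearMap.charpoly_natDegree]

theorem pow_four_eq_of_isSkewAdjoint [NeZero (2 : K)] (hV : Module.finrank K V = 4)
    {B : LinearMap.BilinForm K V} (hB : B.Nondegenerate) {f : Module.End K V}
    (hf : B.IsSkewAdjoint f) :
    f ^ 4 = (LinearMap.trace K V (f ^ 2) / 2) • f ^ 2 - LinearMap.det f • 1 := by
  have : Nontrivial V := Module.nontrivial_of_finrank_pos (R := K) (by omega)
  have h_sq : f.charpoly ^ 2 = expand K 2 (f ^ 2).charpoly := by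
    rw [← charpoly_mul_charpoly_neg, pow_two, ← charpoly_eq_of_isAdjointPair hB (f' := -f) hf]
  have h_trace : (f ^ 2).charpoly.coeff 3 = -LinearMap.trace K V (f ^ 2) := by
    rw [← charpoly_coeff_finrank_pred, hV]
  have h_det : f.charpoly.coeff 0 = LinearMap.det f := by
    rw [LinearMap.det_eq_sign_charpoly_coeff, hV, (by decide : Even 4).neg_one_pow, one_mul]
  have h_cayley := f.aeval_self_charpoly
  rw [eq_quartic_of_sq_eq_expand f.charpoly_monic (f.charpoly_natDegree.trans hV) h_sq,
    h_trace, h_det] at h_cayley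
  simp only [map_add, map_mul, map_pow, aeval_X, aeval_C, Algebra.algebraMap_eq_smul_one,
    neg_div, neg_smul, neg_mul, smul_mul_assoc, one_mul] at h_cayley
  rw [eq_sub_iff_add_eq, ← sub_eq_zero, ← h_cayley]
  abel

end SkewAdjoint

section RankOne

theorem exists_eq_smul_smulRight {K V : Type*} [Field K] [AddCommGroup V] [Module K V]
    [FiniteDimensional K V] {B : LinearMap.BilinForm K V} (hB : B.Nondegenerate)
    (hB_symm : B.IsSymm) {f : Module.End K V} (hf : B.IsSelfAdjoint f)
    (h_rank : Module.finrank K (LinearMap.range f) ≤ 1) :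
    ∃ (m : K) (x : V), f = m • (B x).smulRight x := by
  obtain ⟨⟨x, _⟩, hx⟩ := finrank_le_one_iff.1 h_rank
  have h_line (u : V) : ∃ c : K, f u = c • x := by
    obtain ⟨c, hc⟩ := hx ⟨f u, u, rfl⟩
    exact ⟨c, (Subtype.ext_iff.1 hc).symm⟩
  choose c hc using h_line
  by_cases hx₀ : x = 0
  · exact ⟨0, 0, LinearMap.ext fun u => by simp [hc, hx₀]⟩
  obtain ⟨w, hw⟩ : ∃ w, B x w ≠ 0 := by
    by_contra! h
    exact hx₀ (hB.1 x h)
  have h_coeff (u : V) : c u * B x w = c w * B x u := by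
    have h_adj := hf u w
    simpa [hc, hB_symm.eq u x] using h_adj
  refine ⟨c w / B x w, x, LinearMap.ext fun u => ?_⟩
  rw [hc, eq_div_of_mul_eq hw (h_coeff u)]
  simp [smul_smul, div_mul_eq_mul_div]

theorem exists_eq_smulRight_or_eq_neg {V : Type*} [AddCommGroup V] [Module ℝ V]
    [FiniteDimensional ℝ V] {B : LinearMap.BilinForm ℝ V} (hB : B.Nondegenerate)
    (hB_symm : B.IsSymm) {f : Module.End ℝ V} (hf : B.IsSelfAdjoint f)
    (h_rank : Module.finrank ℝ (LinearMap.range f) ≤ 1) :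
    ∃ k, f = (B k).smulRight k ∨ f = -(B k).smulRight k := by
  obtain ⟨m, x, rfl⟩ := exists_eq_smul_smulRight hB hB_symm hf h_rank
  have h_scale : (B (√|m| • x)).smulRight (√|m| • x) = |m| • (B x).smulRight x := by
    ext u
    simp [smul_smul, mul_right_comm]
  refine ⟨√|m| • x, ?_⟩
  rw [h_scale]
  rcases abs_choice m with h | h <;> rw [h] <;> simp

end RankOne

namespace LorentzianMetric

variable {V : Type*} [AddCommGroup V] [Module ℝ V] (g : LorentzianMetric V)

theorem form_isSymm : g.form.IsSymm := by
  obtain ⟨n, e, he⟩ := g.exists_orthonormal_basis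
  refine (LinearMap.BilinForm.isSymm_iff_basis e).2 fun i j => ?_
  rw [he, he]
  by_cases hij : i = j
  · rw [hij]
  · rw [if_neg hij, if_neg (Ne.symm hij)]

theorem form_comm (u v : V) : g.form u v = g.form v u :=
  g.form_isSymm.eq u v

section Signature

theorem exists_form_self_neg_of_orthogonal :
    ∃ t, ∀ u, g.form t u = 0 → u ≠ 0 → g.form u u < 0 := by
  obtain ⟨n, e, he⟩ := g.exists_orthonormal_basis
  have h_time (u : V) : g.form (e 0) u = e.repr u 0 := by
    conv_lhs => rw [← e.sum_repr u]
    simp [-Module.Basis.sum_repr, he]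
  have h_self (u : V) : g.form u u = e.repr u 0 ^ 2 - ∑ i : Fin n, e.repr u i.succ ^ 2 := by
    conv_lhs => rw [← e.sum_repr u]
    simp [-Module.Basis.sum_repr, he, Fin.sum_univ_succ, (Fin.succ_ne_zero _).symm, pow_two,
      sub_eq_add_neg, ← Finset.sum_neg_distrib]
  refine ⟨e 0, fun u hu hu_ne => ?_⟩
  rw [h_time] at hu
  obtain ⟨i, hi⟩ : ∃ i : Fin n, e.repr u i.succ ≠ 0 := by
    by_contra! h
    refine hu_ne (e.ext_elem fun i => ?_)
    cases i using Fin.cases <;> simp [hu, h]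
  have h_pos : 0 < ∑ i : Fin n, e.repr u i.succ ^ 2 :=
    Finset.sum_pos' (fun _ _ => sq_nonneg _) ⟨i, Finset.mem_univ i, by positivity⟩
  rw [h_self, hu]
  linarith

variable [FiniteDimensional ℝ V]

theorem exists_mem_form_self_neg {W : Submodule ℝ V} (hW : 1 < Module.finrank ℝ W) :
    ∃ u ∈ W, g.form u u < 0 := by
  obtain ⟨t, ht⟩ := g.exists_form_self_neg_of_orthogonal
  obtain ⟨u, hu, hu_ne⟩ := Submodule.exists_mem_ne_zero_of_ne_bot <|
    LinearMap.ker_ne_bot_of_finrank_lt (f := g.form t ∘ₗ W.subtype)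
      (by rwa [Module.finrank_self])
  exact ⟨u, u.2, ht u hu (by simpa using hu_ne)⟩

theorem finrank_le_one_of_isotropic {W : Submodule ℝ V} (hW : ∀ u ∈ W, g.form u u = 0) :
    Module.finrank ℝ W ≤ 1 := by
  by_contra! h
  obtain ⟨u, hu, hu_neg⟩ := g.exists_mem_form_self_neg h
  exact hu_neg.ne (hW u hu)

end Signature

section SelfAdjoint

variable {g} [FiniteDimensional ℝ V] {τ σ : Module.End ℝ V}

theorem nonneg_of_isSelfAdjoint_of_sq_eq_smul (hV : 2 < Module.finrank ℝ V)
    (hτ : g.form.IsSelfAdjoint τ) {f : ℝ} (hf : τ ^ 2 = f • 1) : 0 ≤ f := by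
  obtain ⟨t, ht⟩ := g.exists_form_self_neg_of_orthogonal
  obtain ⟨u, hu, hu_ne⟩ := Submodule.exists_mem_ne_zero_of_ne_bot <|
    LinearMap.ker_ne_bot_of_finrank_lt (f := (g.form t).prod (g.form t ∘ₗ τ))
      (by simpa using hV)
  obtain ⟨hu_orth, hτu_orth⟩ : g.form t u = 0 ∧ g.form t (τ u) = 0 := by simpa using hu
  have h_form : g.form (τ u) (τ u) = f * g.form u u := by
    rw [hτ, ← Module.End.mul_apply, ← pow_two, hf]
    simp
  have h_neg := ht u hu_orth hu_ne
  have h_nonpos : g.form (τ u) (τ u) ≤ 0 := by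
    by_cases h : τ u = 0
    · simp [h]
    · exact (ht _ hτu_orth h).le
  by_contra! hf_neg
  exact (mul_pos_of_neg_of_neg hf_neg h_neg).not_ge (h_form ▸ h_nonpos)

theorem exists_unit_spacelike_eigenvector (hV : 2 < Module.finrank ℝ V)
    (hτ : g.form.IsSelfAdjoint τ) {f : ℝ} (hf : τ ^ 2 = f • 1) :
    ∃ (l : ℝ) (p : V), τ p = l • p ∧ g.form p p = -1 := by
  have hf_nonneg := nonneg_of_isSelfAdjoint_of_sq_eq_smul hV hτ hf
  have h_factor : (τ - √f • 1) * (τ + √f • 1) = 0 := by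
    rw [← (Commute.smul_right (Commute.one_right τ) √f).mul_self_sub_mul_self_eq', ← pow_two, hf,
      smul_mul_smul_comm, Real.mul_self_sqrt hf_nonneg, one_mul, sub_self]
  have h_range : LinearMap.range (τ + √f • 1) ≤ LinearMap.ker (τ - √f • 1) :=
    LinearMap.range_le_ker_iff.2 h_factor
  have h_finrank := (τ + √f • 1).finrank_range_add_finrank_ker
  have h_le := Submodule.finrank_mono h_range
  obtain ⟨l, hl⟩ : ∃ l : ℝ, 1 < Module.finrank ℝ (LinearMap.ker (τ - l • 1)) := by
    by_contra! h
    have h_pos := h √f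
    have h_neg := h (-√f)
    rw [neg_smul, sub_neg_eq_add] at h_neg
    omega
  obtain ⟨u, hu, hu_neg⟩ := g.exists_mem_form_self_neg hl
  have hu_eigen : τ u = l • u := by simpa [sub_eq_zero] using hu
  have h_norm : √(-g.form u u) ^ 2 = -g.form u u := Real.sq_sqrt (by linarith)
  refine ⟨l, (√(-g.form u u))⁻¹ • u, by rw [map_smul, hu_eigen, smul_comm], ?_⟩
  simp only [map_smul, LinearMap.smul_apply, smul_eq_mul]
  rw [← mul_assoc, ← pow_two, inv_pow, h_norm, inv_neg, neg_mul,
    inv_mul_cancel₀ hu_neg.ne]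

theorem finrank_range_le_one_of_sq_eq_trace_smul (hσ : g.form.IsSelfAdjoint σ)
    (h : σ ^ 2 = LinearMap.trace ℝ V σ • σ) : Module.finrank ℝ (LinearMap.range σ) ≤ 1 := by
  set c := LinearMap.trace ℝ V σ with hc
  by_cases hc₀ : c = 0
  · refine g.finrank_le_one_of_isotropic ?_
    rintro _ ⟨u, rfl⟩
    rw [hσ, ← Module.End.mul_apply, ← pow_two, h, hc₀]
    simp
  · have h_idem : IsIdempotentElem (c⁻¹ • σ) := by
      rw [IsIdempotentElem, smul_mul_smul_comm, ← pow_two σ, h, smul_smul]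
      field_simp
    have h_trace := (LinearMap.IsIdempotentElem.isProj_range _ h_idem).trace
    rw [map_smul, smul_eq_mul, ← hc, inv_mul_cancel₀ hc₀,
      LinearMap.range_smul _ _ (inv_ne_zero hc₀)] at h_trace
    exact_mod_cast h_trace.ge

end SelfAdjoint

section Tensors

variable [FiniteDimensional ℝ V] {g} {S T F : LinearMap.BilinForm ℝ V}

theorem raise_eq_iff {f : Module.End ℝ V} :
    g.raise T = f ↔ ∀ u v, g.form (f u) v = T u v := by
  refine ⟨?_, fun h => LinearMap.ext fun u => ?_⟩
  · rintro rfl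
    exact g.form_raise T
  · refine (g.form.toDual g.form_nondegenerate).injective (LinearMap.ext fun v => ?_)
    exact (g.form_raise T u v).trans (h u v).symm

theorem raise_injective : Function.Injective g.raise := fun S T h => by
  ext u v
  rw [← g.form_raise, h, g.form_raise]

theorem raise_neg : g.raise (-T) = -g.raise T :=
  LinearMap.comp_neg _ _

theorem raise_add : g.raise (S + T) = g.raise S + g.raise T :=
  LinearMap.comp_add _ _ _

theorem raise_smul (c : ℝ) : g.raise (c • T) = c • g.raise T :=
  LinearMap.comp_smul _ _ _

theorem raise_form : g.raise g.form = 1 :=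
  raise_eq_iff.2 fun _ _ => rfl

theorem isSelfAdjoint_raise (hT : T.IsSymm) : g.form.IsSelfAdjoint (g.raise T) := fun u v => by
  rw [g.form_raise, hT.eq, g.form_comm, g.form_raise]

theorem isSkewAdjoint_raise (hF : F.IsAlt) : g.form.IsSkewAdjoint (g.raise F) := fun u v => by
  rw [g.form_raise, Pi.neg_apply, map_neg, g.form_comm, g.form_raise, hF.neg_eq]

theorem cross_apply (u v : V) : g.cross S T u v = g.form (g.raise S u) (g.raise T v) :=
  (g.form_raise S u _).symm

theorem cross_self_isSymm : (g.cross T T).IsSymm where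
  eq u v := by rw [cross_apply, cross_apply, g.form_comm]

theorem raise_cross_of_isSymm (hT : T.IsSymm) : g.raise (g.cross S T) = g.raise T * g.raise S :=
  raise_eq_iff.2 fun u v => by rw [cross_apply, ← isSelfAdjoint_raise hT, Module.End.mul_apply]

theorem raise_cross_of_isAlt (hF : F.IsAlt) :
    g.raise (g.cross S F) = -(g.raise F * g.raise S) :=
  raise_eq_iff.2 fun u v => by
    have h_skew := isSkewAdjoint_raise (g := g) hF (g.raise S u) v
    rw [Pi.neg_apply, map_neg] at h_skew
    rw [cross_apply, LinearMap.neg_apply, map_neg, LinearMap.neg_apply, Module.End.mul_apply,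
      h_skew, neg_neg]

theorem cross_self_eq_smul_form_iff (hT : T.IsSymm) {f : ℝ} :
    g.cross T T = f • g.form ↔ g.raise T ^ 2 = f • 1 := by
  rw [← raise_injective.eq_iff, raise_cross_of_isSymm hT, raise_smul, raise_form, pow_two]

theorem cross_neg_neg : g.cross (-S) (-T) = g.cross S T := by
  ext u v
  simp [cross_apply, raise_neg]

theorem trace_neg : g.trace (-T) = -g.trace T := by
  rw [trace, raise_neg, map_neg, trace]

end Tensors

section Maxwell

variable {g} {F : LinearMap.BilinForm ℝ V}

variable (g) in
/-- The simple 2-form `k ∧ p = k_a p_b - p_a k_b`. -/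
def wedge (k p : V) : LinearMap.BilinForm ℝ V :=
  LinearMap.BilinForm.linMulLin (g.form k) (g.form p) -
    LinearMap.BilinForm.linMulLin (g.form p) (g.form k)

theorem wedge_isAlt (k p : V) : (g.wedge k p).IsAlt := fun u => by
  simp [wedge, mul_comm]

variable [FiniteDimensional ℝ V]

theorem maxwellTensor_isSymm : (g.maxwellTensor F).IsSymm :=
  cross_self_isSymm.neg.add (g.form_isSymm.smul _)

theorem raise_maxwellTensor (hF : F.IsAlt) :
    g.raise (g.maxwellTensor F) =
      g.raise F ^ 2 - (LinearMap.trace ℝ V (g.raise F ^ 2) / 4) • 1 := by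
  rw [maxwellTensor, dot, trace, raise_add, raise_neg, raise_smul, raise_form,
    raise_cross_of_isAlt hF, ← pow_two, map_neg, neg_neg]
  module

theorem trace_maxwellTensor (hV : Module.finrank ℝ V = 4) (hF : F.IsAlt) :
    g.trace (g.maxwellTensor F) = 0 := by
  rw [trace, raise_maxwellTensor hF, map_sub, map_smul, LinearMap.trace_one, hV, smul_eq_mul]
  norm_num

theorem cross_maxwellTensor_self (hV : Module.finrank ℝ V = 4) (hF : F.IsAlt) :
    g.cross (g.maxwellTensor F) (g.maxwellTensor F) =
      (LinearMap.trace ℝ V (g.raise F ^ 2) ^ 2 / 16 - LinearMap.det (g.raise F)) • g.form := by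
  rw [cross_self_eq_smul_form_iff maxwellTensor_isSymm, raise_maxwellTensor hF]
  set φ := g.raise F
  set c := LinearMap.trace ℝ V (φ ^ 2)
  have h_cayley : φ ^ 2 * φ ^ 2 = (c / 2) • φ ^ 2 - LinearMap.det φ • 1 := by
    rw [← pow_add]
    exact pow_four_eq_of_isSkewAdjoint hV g.form_nondegenerate (isSkewAdjoint_raise hF)
  rw [pow_two (φ ^ 2 - _), sub_mul, mul_sub, mul_sub, h_cayley]
  simp only [smul_one_mul, mul_smul_one, smul_smul]
  module

theorem raise_wedge_sq {k p : V} (hkp : g.form k p = 0) (hp : g.form p p = -1) :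
    g.raise (g.wedge k p) ^ 2 =
      (g.form k).smulRight k - g.form k k • (g.form p).smulRight p := by
  have h_raise : g.raise (g.wedge k p) = (g.form k).smulRight p - (g.form p).smulRight k :=
    raise_eq_iff.2 fun u v => by simp [wedge]
  have hpk : g.form p k = 0 := (g.form_comm p k).trans hkp
  ext u
  simp only [h_raise, pow_two, Module.End.mul_apply, LinearMap.sub_apply, LinearMap.smul_apply,
    LinearMap.smulRight_apply, map_sub, map_smul, hkp, hpk, hp]
  module

theorem raise_maxwellTensor_wedge {k p : V} (hkp : g.form k p = 0) (hp : g.form p p = -1) :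
    g.raise (g.maxwellTensor (g.wedge k p)) =
      (g.form k).smulRight k - g.form k k • (g.form p).smulRight p - (g.form k k / 2) • 1 := by
  rw [raise_maxwellTensor (wedge_isAlt k p), raise_wedge_sq hkp hp, map_sub, map_smul,
    LinearMap.trace_smulRight, LinearMap.trace_smulRight, hp, smul_eq_mul]
  module

end Maxwell

section Converse

variable {g} {τ : Module.End ℝ V} {T : LinearMap.BilinForm ℝ V} {l : ℝ} {p : V}

variable (g) in
/-- The endomorphism `τ_a{}^b + l δ_a{}^b + 2 l p_a p^b`. If `τ` comes from the Maxwell tensor of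
`k ∧ p`, where `p` is a unit spacelike vector orthogonal to `k`, and `l` is its eigenvalue at `p`,
then this is `k_a k^b`. -/
def shift (τ : Module.End ℝ V) (l : ℝ) (p : V) : Module.End ℝ V :=
  τ + l • 1 + (2 * l) • (g.form p).smulRight p

theorem shift_apply (u : V) : g.shift τ l p u = τ u + l • u + (2 * l * g.form p u) • p := by
  simp [shift, smul_smul]

theorem shift_apply_self (hp : g.form p p = -1) (hτp : τ p = l • p) : g.shift τ l p p = 0 := by
  rw [shift_apply, hp, hτp]
  module

theorem isSelfAdjoint_shift (hτ : g.form.IsSelfAdjoint τ) :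
    g.form.IsSelfAdjoint (g.shift τ l p) := fun u v => by
  simp only [shift_apply, map_add, map_smul, LinearMap.add_apply, LinearMap.smul_apply,
    smul_eq_mul, hτ u v, g.form_comm u p]
  ring

theorem shift_sq (hτ : g.form.IsSelfAdjoint τ) (hτ_sq : τ ^ 2 = l ^ 2 • 1)
    (hp : g.form p p = -1) (hτp : τ p = l • p) :
    g.shift τ l p ^ 2 = (2 * l) • g.shift τ l p := by
  ext u
  have hττ : τ (τ u) = l ^ 2 • u := by
    rw [← Module.End.mul_apply, ← pow_two, hτ_sq, LinearMap.smul_apply, Module.End.one_apply]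
  have h_orth : g.form p (g.shift τ l p u) = 0 := by
    rw [← isSelfAdjoint_shift hτ, shift_apply_self hp hτp, map_zero, LinearMap.zero_apply]
  rw [pow_two, Module.End.mul_apply, shift_apply (g.shift τ l p u), h_orth, LinearMap.smul_apply,
    shift_apply]
  simp only [map_add, map_smul, hττ, hτp]
  module

variable [FiniteDimensional ℝ V]

theorem trace_shift (hp : g.form p p = -1) :
    LinearMap.trace ℝ V (g.shift τ l p) =
      LinearMap.trace ℝ V τ + (Module.finrank ℝ V - 2) * l := by
  simp only [shift, map_add, map_smul, LinearMap.trace_one, LinearMap.trace_smulRight, hp,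
    smul_eq_mul]
  ring

theorem eq_maxwellTensor_wedge_of_shift_eq (hV : Module.finrank ℝ V = 4) (hT : g.trace T = 0)
    (hp : g.form p p = -1) (hTp : g.raise T p = l • p) {k : V}
    (hk : g.shift (g.raise T) l p = (g.form k).smulRight k) :
    T = g.maxwellTensor (g.wedge k p) := by
  have h_orth : g.form k p = 0 := by
    have h_zero : g.form k p • k = 0 := by
      rw [← LinearMap.smulRight_apply, ← hk, shift_apply_self hp hTp]
    rcases smul_eq_zero.1 h_zero with h | rfl
    · exact h
    · simp
  have h_norm : g.form k k = 2 * l := by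
    rw [← LinearMap.trace_smulRight, ← hk, trace_shift hp, hV, ← trace, hT]
    norm_num
  refine raise_injective (g := g) ?_
  rw [raise_maxwellTensor_wedge h_orth hp, ← hk, h_norm, shift]
  module

theorem exists_eq_maxwellTensor_or_eq_neg (hV : Module.finrank ℝ V = 4) (hT : T.IsSymm) {f : ℝ}
    (hf : g.cross T T = f • g.form) (htr : g.trace T = 0) :
    ∃ k p : V, T = g.maxwellTensor (g.wedge k p) ∨ T = -g.maxwellTensor (g.wedge k p) := by
  have hτ := isSelfAdjoint_raise (g := g) hT
  have hτ_sq := (cross_self_eq_smul_form_iff hT).1 hf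
  obtain ⟨l, p, hTp, hp⟩ := exists_unit_spacelike_eigenvector (by omega) hτ hτ_sq
  have hfl : f = l ^ 2 := by
    have h_eval : f * g.form p p = l ^ 2 * g.form p p := by
      have := congr_arg (g.form p) (LinearMap.congr_fun hτ_sq p)
      simpa [pow_two, hTp, mul_assoc] using this.symm
    simpa [hp] using h_eval
  have h_trace : LinearMap.trace ℝ V (g.shift (g.raise T) l p) = 2 * l := by
    rw [trace_shift hp, hV, ← trace, htr]
    norm_num
  have h_rank := finrank_range_le_one_of_sq_eq_trace_smul (isSelfAdjoint_shift hτ)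
    (h_trace ▸ shift_sq hτ (hfl ▸ hτ_sq) hp hTp)
  obtain ⟨k, hk | hk⟩ := exists_eq_smulRight_or_eq_neg g.form_nondegenerate g.form_isSymm
    (isSelfAdjoint_shift hτ) h_rank
  · exact ⟨k, p, Or.inl (eq_maxwellTensor_wedge_of_shift_eq hV htr hp hTp hk)⟩
  · have h_neg_eigen : g.raise (-T) p = -l • p := by
      rw [raise_neg, LinearMap.neg_apply, hTp, neg_smul]
    have h_neg_shift : g.shift (g.raise (-T)) (-l) p = (g.form k).smulRight k := by
      rw [← neg_neg ((g.form k).smulRight k), ← hk, raise_neg, shift, shift]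
      module
    have h_neg : -T = g.maxwellTensor (g.wedge k p) :=
      eq_maxwellTensor_wedge_of_shift_eq hV (by rw [trace_neg, htr, neg_zero]) hp h_neg_eigen
        h_neg_shift
    exact ⟨k, p, Or.inr (by rw [← h_neg]; ext; simp)⟩

end Converse

end LorentzianMetric

theorem mainTheorem9 {V : Type*} [AddCommGroup V] [Module ℝ V] [FiniteDimensional ℝ V]
    (hV : Module.finrank ℝ V = 4) (g : LorentzianMetric V) (T : LinearMap.BilinForm ℝ V) :
    (∃ F : LinearMap.BilinForm ℝ V, F.IsAlt ∧
      (T = g.maxwellTensor F ∨ T = -g.maxwellTensor F)) ↔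
    T.IsSymm ∧ (∃ f : ℝ, g.cross T T = f • g.form) ∧ g.trace T = 0 := by
  constructor
  · rintro ⟨F, hF, rfl | rfl⟩
    · exact ⟨LorentzianMetric.maxwellTensor_isSymm,
        ⟨_, LorentzianMetric.cross_maxwellTensor_self hV hF⟩,
        LorentzianMetric.trace_maxwellTensor hV hF⟩
    · have h_cross := LorentzianMetric.cross_maxwellTensor_self (g := g) hV hF
      refine ⟨LorentzianMetric.maxwellTensor_isSymm.neg,
        ⟨_, LorentzianMetric.cross_neg_neg.trans h_cross⟩, ?_⟩
      rw [LorentzianMetric.trace_neg, LorentzianMetric.trace_maxwellTensor hV hF, neg_zero]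
  · rintro ⟨h_symm, ⟨f, hf⟩, h_trace⟩
    obtain ⟨k, p, h⟩ := LorentzianMetric.exists_eq_maxwellTensor_or_eq_neg hV h_symm hf h_trace
    exact ⟨g.wedge k p, LorentzianMetric.wedge_isAlt k p, h⟩
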